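/- Consider $k$ LQR tasks $(A_i,B_i,Q_i,R_i)_{i=1}^k$ with state space $\mathbb R^d$, action space $\mathbb R^r$ and positive semidefinite (symmetric) $Q_i\in\mathbb R^{d\times d}$, $R_i\in\mathbb R^{r\times r}$. Let the initial state $s_0$ have a common law $T_0$ with $\mathbb E\|s_0\|^2<\infty$. A policy $W\in\mathbb R^{r\times d}$ acts by $a_t=-Ws_t$, giving $s_{t+1}=A_is_t+B_ia_t=(A_i-B_iW)s_t$; it is stable for task $i$ if all these trajectories tend to $0$. The cost of a stable policy is $$C_i(W)=\mathbb E_{s_0\sim T_0}\sum_{t=0}^\infty\bigl(s_t^\top Q_is_t+a_t^\top R_ia_t\bigr),$$ and $C_i(W)=+\infty$ for an unstable $W$. Identify $\mathbb R^{r\times d}$ with the Euclidean space $\mathbb R^{rd}$; $\nabla C_i$ and $\nabla^2C_i$ are the gradient and Hessian there, $\|\nabla C_i\|$ is the Euclidean norm and $\|\nabla^2 C_i\|$ the $\ell_2$ operator norm. Theorem. Assume $A_1=\dots=A_k$, $B_1=\dots=B_k$, and that there are $\alpha_1,\dots,\alpha_k>0$ with $\alpha_1Q_1=\dots=\alpha_kQ_k$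 and $\alpha_1R_1=\dots=\alpha_kR_k$. Let $\eta>0$, $\omega_1,\dots,\omega_k\ge0$, and let $$h(W)=\sum_{i=1}^k\omega_i\,C_i\!\left(W-\eta\frac{\nabla C_i(W)}{\|\nabla C_i(W)\|}\right)$$ for stable $W$ (no step is made where $\nabla C_i(W)=0$; $0\cdot\infty=0$), and $h(W)=+\infty$ for unstable $W$. Let $W^\star$ be a local minimizer of $h$ with $h(W^\star)<\infty$ such that, for some $i$, $$\eta<\frac{\|\nabla C_i(W^\star)\|}{\|\nabla^2C_i(W^\star)\|},\quad\text{that is,}\quad \eta\,\|\nabla^2C_i(W^\star)\|<\|\nabla C_i(W^\star)\|.$$ Then $W^\star$ is a global minimizer of $h$: $h(W^\star)\le h(W)$ for all $W\in\mathbb R^{r\times d}$. -/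

import Mathlib

open MeasureTheory Filter Topology
open scoped ENNReal NNReal Matrix

namespace LQR

/-- Data of a linear-quadratic regulator task with state space `ℝ^d` and action space `ℝ^r`:
dynamics `s_{t+1} = A s_t + B a_t`, stage cost `sᵀ Q s + aᵀ R a`. -/
structure Task (d r : ℕ) where
  A : Matrix (Fin d) (Fin d) ℝ
  B : Matrix (Fin d) (Fin r) ℝ
  Q : Matrix (Fin d) (Fin d) ℝ
  R : Matrix (Fin r) (Fin r) ℝ
  Q_posSemidef : Q.PosSemidef
  R_posSemidef : R.PosSemidef

/-- The parameter space `ℝ^{r × d}` of linear policies `a = -W s`. The `r × d` matrices are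
identified with vectors of length `r * d`, with the Euclidean (that is, Frobenius) inner product,
so that gradients, Hessians and their norms are the Euclidean ones. -/
abbrev Policy (d r : ℕ) := EuclideanSpace ℝ (Fin r × Fin d)

/-- The `r × d` matrix `W` of a policy. -/
def Policy.mat {d r : ℕ} (w : Policy d r) : Matrix (Fin r) (Fin d) ℝ :=
  Matrix.of fun i j => w (i, j)

/-- The action `a = -W s`. -/
def Policy.action {d r : ℕ} (w : Policy d r) (s : Fin d → ℝ) : Fin r → ℝ :=
  -(w.mat *ᵥ s)

namespace Task

variable {d r : ℕ}

/-- The closed-loop trajectory `s_{t+1} = A s_t + B a_t`, `a_t = -W s_t`, started at `s₀`. -/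
def traj (T : Task d r) (w : Policy d r) (s₀ : Fin d → ℝ) : ℕ → Fin d → ℝ
  | 0 => s₀
  | t + 1 => T.A *ᵥ T.traj w s₀ t + T.B *ᵥ w.action (T.traj w s₀ t)

/-- A policy is stable (stabilizing) if every closed-loop trajectory tends to `0`. -/
def Stable (T : Task d r) (w : Policy d r) : Prop :=
  ∀ s₀ : Fin d → ℝ, Tendsto (T.traj w s₀) atTop (𝓝 0)

/-- The (nonnegative) stage cost `sᵀ Q s + aᵀ R a`. -/
def stageCost (T : Task d r) (s : Fin d → ℝ) (a : Fin r → ℝ) : ℝ :=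
  s ⬝ᵥ (T.Q *ᵥ s) + a ⬝ᵥ (T.R *ᵥ a)

open Classical in
/-- The cost `C(W) = 𝔼_{s₀ ∼ T₀} ∑_t (s_tᵀ Q s_t + a_tᵀ R a_t)` of a stable policy; the cost of an
unstable policy is `∞`. -/
noncomputable def cost (T : Task d r) (T₀ : Measure (Fin d → ℝ)) (w : Policy d r) : ℝ≥0∞ :=
  if T.Stable w then
    ∫⁻ s₀, ∑' t : ℕ, ENNReal.ofReal (T.stageCost (T.traj w s₀ t) (w.action (T.traj w s₀ t))) ∂T₀
  else ∞

/-- `∇ C(W)`. It is meaningful at stable policies, where `C` is finite and smooth. -/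
noncomputable def grad (T : Task d r) (T₀ : Measure (Fin d → ℝ)) (w : Policy d r) : Policy d r :=
  gradient (fun v => (T.cost T₀ v).toReal) w

/-- `∇² C(W)`, as a linear operator on the parameter space (so that its norm is the operator norm
for the Euclidean norm). It is meaningful at stable policies. -/
noncomputable def hess (T : Task d r) (T₀ : Measure (Fin d → ℝ)) (w : Policy d r) :
    Policy d r →L[ℝ] Policy d r :=
  fderiv ℝ (T.grad T₀) w

/-- The normalized adaptation step `W - η ∇C(W) / ‖∇C(W)‖` (no step is made if `∇C(W) = 0`). -/
noncomputable def adapt (T : Task d r) (T₀ : Measure (Fin d → ℝ)) (η : ℝ) (w : Policy d r) :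
    Policy d r :=
  w - (η / ‖T.grad T₀ w‖) • T.grad T₀ w

end Task

open Classical in
/-- The normalized-gradient MAML objective `h(W) = ∑ᵢ ωᵢ Cᵢ(W - η ∇Cᵢ(W) / ‖∇Cᵢ(W)‖)`; it is `∞`
where some `Cᵢ(W)` is infinite because `W` is unstable (there `∇Cᵢ(W)` does not exist). -/
noncomputable def mamlObjective {d r k : ℕ} (T : Fin k → Task d r) (T₀ : Measure (Fin d → ℝ))
    (ω : Fin k → ℝ≥0) (η : ℝ) (w : Policy d r) : ℝ≥0∞ :=
  if ∀ i, (T i).Stable w then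
    ∑ i, (ω i : ℝ≥0∞) * (T i).cost T₀ ((T i).adapt T₀ η w)
  else ∞

end LQR

/-! All costs are positive multiples of a single cost C. Normalizing the gradient removes the
factor, so all tasks share one adaptation map U, and on stable policies h = K · (C ∘ U) for a finite
constant K ≥ 0. If K > 0, two facts give the result.

Openness of U at W⋆ (`map_nhds_sub_normalized_eq`): when η‖∇²C‖ < ‖∇C‖, the normalized gradient term
is locally Lipschitz with constant below 1. Thus U maps neighborhoods of W⋆ onto neighborhoods of
U(W⋆), and U(W⋆) is a local minimizer of C.

Local minimizers of C are global (`cost_le_of_isLocalMin`). The second moments of the initial state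
may be degenerate, so a zero gradient is not enough. Let P be the value matrix and E = R W - Bᵀ P
A_W, where A_W = A - B W. A small step along -E lowers the cost from every initial state at once, by
at least a multiple of ∑ ‖E s_t‖² along the new trajectory. Local minimality therefore forces E s_t
= 0 along almost every trajectory. There 2 P s_t satisfies the costate equations, and convexity of
the stage cost makes the trajectory optimal among those of stable policies. -/

/-! ### Vanishing powers and the Stein equation in a normed ring -/

section NormedRing

theorem tendsto_pow_atTop_nhds_zero_of_norm_pow_lt_one {E : Type*} [NormedRing E]
    {a : E} {N : ℕ} (h : ‖a ^ N‖ < 1) : Tendsto (fun n => a ^ n) atTop (𝓝 0) := by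
  rcases Nat.eq_zero_or_pos N with rfl | hN
  · have h1 : ‖(1 : E)‖ < 1 := by simpa using h
    have h2 := tendsto_pow_atTop_nhds_zero_of_norm_lt_one h1
    simp only [one_pow] at h2
    have h0 : (1 : E) = 0 := tendsto_nhds_unique tendsto_const_nhds h2
    have h3 : ∀ x : E, x = 0 := fun x => by rw [← mul_one x, h0, mul_zero]
    simp only [h3]
    exact tendsto_const_nhds
  have h1 : Tendsto (fun n => (a ^ N) ^ (n / N)) atTop (𝓝 0) :=
    (tendsto_pow_atTop_nhds_zero_of_norm_lt_one h).comp
      (Nat.tendsto_div_const_atTop hN.ne')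
  have h2 : IsBoundedUnder (· ≤ ·) atTop (norm ∘ fun n => a ^ (n % N)) := by
    refine ⟨∑ j ∈ Finset.range N, ‖a ^ j‖, ?_⟩
    simp only [eventually_map]
    refine Eventually.of_forall fun n => ?_
    exact Finset.single_le_sum (f := fun j => ‖a ^ j‖) (fun _ _ => norm_nonneg _)
      (Finset.mem_range.2 (Nat.mod_lt n hN))
  refine (h1.zero_mul_isBoundedUnder_le h2).congr fun n => ?_
  rw [← pow_mul, ← pow_add, Nat.div_add_mod]

variable {𝔸 : Type*} [NormedRing 𝔸] [NormedAlgebra ℝ 𝔸]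

theorem mulLeftRight_pow (a b : 𝔸) (n : ℕ) :
    ContinuousLinearMap.mulLeftRight ℝ 𝔸 a b ^ n =
      ContinuousLinearMap.mulLeftRight ℝ 𝔸 (a ^ n) (b ^ n) := by
  induction n with
  | zero => ext; simp
  | succ n ih =>
    ext x
    rw [pow_succ, ih, mul_apply_eq_comp]
    simp only [ContinuousLinearMap.mulLeftRight_apply]
    rw [pow_succ, pow_succ' b]
    simp only [mul_assoc]

/-- The solution `x` of the discrete Lyapunov (Stein) equation `x = m + a x b`. -/
noncomputable def steinSol (a b m : 𝔸) : 𝔸 :=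
  Ring.inverse (1 - ContinuousLinearMap.mulLeftRight ℝ 𝔸 a b) m

variable [CompleteSpace 𝔸]

/-- The powers of L : x ↦ a x b tend to 0, so 1 - L ^ N is a unit for some N. The geometric sum
exhibits 1 - L as a factor of it, commuting with the cofactor. -/
theorem isUnit_one_sub_mulLeftRight {a b : 𝔸} (ha : Tendsto (fun n => a ^ n) atTop (𝓝 0))
    (hb : Tendsto (fun n => b ^ n) atTop (𝓝 0)) :
    IsUnit (1 - ContinuousLinearMap.mulLeftRight ℝ 𝔸 a b) := by
  have h1 : Tendsto (fun n => ContinuousLinearMap.mulLeftRight ℝ 𝔸 a b ^ n) atTop (𝓝 0) := by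
    simp only [mulLeftRight_pow]
    have h3 : Continuous fun p : 𝔸 × 𝔸 => ContinuousLinearMap.mulLeftRight ℝ 𝔸 p.1 p.2 := by
      fun_prop
    have := (h3.tendsto (0, 0)).comp (ha.prodMk_nhds hb)
    simpa [Function.comp_def] using this
  have h2 := h1.norm
  rw [norm_zero] at h2
  obtain ⟨N, hN⟩ := (h2.eventually (gt_mem_nhds one_pos)).exists
  have h3 := isUnit_one_sub_of_norm_lt_one hN
  rw [← mul_neg_geom_sum] at h3
  refine (Commute.isUnit_mul_iff ?_ |>.1 h3).1
  rw [commute_iff_eq, mul_neg_geom_sum, geom_sum_mul_neg]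

theorem steinSol_eq {a b : 𝔸} (ha : Tendsto (fun n => a ^ n) atTop (𝓝 0))
    (hb : Tendsto (fun n => b ^ n) atTop (𝓝 0)) (m : 𝔸) :
    steinSol a b m = m + a * steinSol a b m * b := by
  have h := congrArg (fun f : 𝔸 →L[ℝ] 𝔸 => f m)
    (Ring.mul_inverse_cancel _ (isUnit_one_sub_mulLeftRight ha hb))
  simp only [mul_apply_eq_comp, sub_apply, one_apply_eq_self,
    ContinuousLinearMap.mulLeftRight_apply] at h
  exact sub_eq_iff_eq_add.1 h

theorem contDiffAt_steinSol {E : Type*} [NormedAddCommGroup E] [NormedSpace ℝ E] {a b m : E → 𝔸}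
    {x : E} {n : WithTop ℕ∞} (ha : ContDiffAt ℝ n a x) (hb : ContDiffAt ℝ n b x)
    (hm : ContDiffAt ℝ n m x) (ha' : Tendsto (fun n => a x ^ n) atTop (𝓝 0))
    (hb' : Tendsto (fun n => b x ^ n) atTop (𝓝 0)) :
    ContDiffAt ℝ n (fun y => steinSol (a y) (b y) (m y)) x := by
  obtain ⟨u, hu⟩ := isUnit_one_sub_mulLeftRight ha' hb'
  have h1 : ContDiffAt ℝ n (fun y => 1 - ContinuousLinearMap.mulLeftRight ℝ 𝔸 (a y) (b y)) x := by
    refine contDiffAt_const.sub (ContDiffAt.clm_apply ?_ hb)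
    have h0 : ContDiff ℝ n fun z : 𝔸 => ContinuousLinearMap.mulLeftRight ℝ 𝔸 z :=
      ContinuousLinearMap.contDiff _
    exact h0.contDiffAt.comp x ha
  have h2 := contDiffAt_ringInverse ℝ (n := n) u
  rw [hu] at h2
  exact (h2.comp x h1).clm_apply hm

end NormedRing

/-! ### Closed loop, stability and smooth value matrices -/

namespace LQR
namespace Task

variable {d r : ℕ}

/-- The closed-loop matrix `A - B W`. -/
def closedLoop (T : Task d r) (w : Policy d r) : Matrix (Fin d) (Fin d) ℝ :=
  T.A - T.B * w.mat

/-- The closed-loop stage cost matrix `Q + Wᵀ R W`. -/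
def costMatrix (T : Task d r) (w : Policy d r) : Matrix (Fin d) (Fin d) ℝ :=
  T.Q + w.matᵀ * T.R * w.mat

theorem transpose_costMatrix (T : Task d r) (w : Policy d r) :
    (T.costMatrix w)ᵀ = T.costMatrix w := by
  have hQ : T.Qᵀ = T.Q := T.Q_posSemidef.1
  have hR : T.Rᵀ = T.R := T.R_posSemidef.1
  simp [costMatrix, hQ, hR, Matrix.mul_assoc]

/-- `P` is a symmetric solution of the Lyapunov equation `P = Q + Wᵀ R W + A_Wᵀ P A_W`. -/
structure IsValueMatrix (T : Task d r) (w : Policy d r) (P : Matrix (Fin d) (Fin d) ℝ) :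
    Prop where
  symm : Pᵀ = P
  eq : P = T.costMatrix w + (T.closedLoop w)ᵀ * P * T.closedLoop w

theorem traj_eq (T : Task d r) (w : Policy d r) (s : Fin d → ℝ) (t : ℕ) :
    T.traj w s t = (T.closedLoop w ^ t) *ᵥ s := by
  induction t with
  | zero => simp [traj]
  | succ t ih =>
    rw [traj, ih, pow_succ', ← Matrix.mulVec_mulVec, closedLoop, Policy.action,
      Matrix.sub_mulVec, Matrix.mulVec_neg, Matrix.mulVec_mulVec _ T.B, ← sub_eq_add_neg]

theorem traj_succ (T : Task d r) (w : Policy d r) (s : Fin d → ℝ) (t : ℕ) :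
    T.traj w s (t + 1) = T.closedLoop w *ᵥ T.traj w s t := by
  rw [traj_eq, traj_eq, pow_succ', Matrix.mulVec_mulVec]

theorem continuous_traj (T : Task d r) (w : Policy d r) (t : ℕ) :
    Continuous fun s => T.traj w s t := by
  simp only [traj_eq]
  fun_prop

theorem stageCost_action (T : Task d r) (w : Policy d r) (s : Fin d → ℝ) :
    T.stageCost s (w.action s) = s ⬝ᵥ (T.costMatrix w *ᵥ s) := by
  simp only [stageCost, Policy.action, costMatrix, Matrix.add_mulVec, dotProduct_add,
    Matrix.mulVec_neg, neg_dotProduct_neg, ← Matrix.mulVec_mulVec]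
  rw [Matrix.dotProduct_mulVec s w.matᵀ, Matrix.vecMul_transpose]

theorem stageCost_nonneg (T : Task d r) (s : Fin d → ℝ) (a : Fin r → ℝ) :
    0 ≤ T.stageCost s a := by
  have h1 := T.Q_posSemidef.dotProduct_mulVec_nonneg s
  have h2 := T.R_posSemidef.dotProduct_mulVec_nonneg a
  simp only [star_trivial] at h1 h2
  exact add_nonneg h1 h2

theorem stable_iff_tendsto_pow (T : Task d r) (w : Policy d r) :
    T.Stable w ↔ Tendsto (fun n => T.closedLoop w ^ n) atTop (𝓝 0) := by
  constructor
  · intro h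
    refine tendsto_pi_nhds.2 fun i => tendsto_pi_nhds.2 fun j => ?_
    have := tendsto_pi_nhds.1 (h (Pi.single j 1)) i
    simpa [traj_eq, Matrix.mulVec_single_one] using this
  · intro h s
    have hc : Continuous fun X : Matrix (Fin d) (Fin d) ℝ => X *ᵥ s := by fun_prop
    have := (hc.tendsto 0).comp h
    rw [Matrix.zero_mulVec] at this
    exact this.congr fun n => (T.traj_eq w s n).symm

theorem continuous_mat : Continuous (Policy.mat : Policy d r → Matrix (Fin r) (Fin d) ℝ) := by
  refine continuous_pi fun i => continuous_pi fun j => ?_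
  change Continuous fun w : Policy d r => w (i, j)
  fun_prop

theorem continuous_closedLoop (T : Task d r) : Continuous T.closedLoop := by
  unfold closedLoop
  have := continuous_mat (d := d) (r := r)
  fun_prop

section Norm

attribute [local instance] Matrix.linftyOpNormedRing Matrix.linftyOpNormedAlgebra

/-- Powers tend to 0 as soon as one of them has norm below 1, and for a fixed exponent this is an
open condition. -/
theorem isOpen_stable (T : Task d r) : IsOpen {w | T.Stable w} := by
  have : {w | T.Stable w} = ⋃ N : ℕ, {w | ‖T.closedLoop w ^ N‖ < 1} := by
    ext w
    simp only [Set.mem_ofPred_eq, Set.mem_iUnion, stable_iff_tendsto_pow]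
    constructor
    · intro h
      have h1 := h.norm
      rw [norm_zero] at h1
      exact (h1.eventually (gt_mem_nhds one_pos)).exists
    · rintro ⟨N, hN⟩
      exact tendsto_pow_atTop_nhds_zero_of_norm_pow_lt_one hN
  rw [this]
  refine isOpen_iUnion fun N => isOpen_lt ?_ continuous_const
  exact (T.continuous_closedLoop.pow N).norm

theorem contDiff_matrix {E : Type*} [NormedAddCommGroup E] [NormedSpace ℝ E]
    {X : E → Matrix (Fin d) (Fin d) ℝ} {n : WithTop ℕ∞}
    (h : ∀ i j, ContDiff ℝ n fun x => X x i j) : ContDiff ℝ n X := by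
  have : X = fun x => ∑ i, ∑ j, X x i j • Matrix.single i j (1 : ℝ) := by
    funext x
    conv_lhs => rw [Matrix.matrix_eq_sum_single (X x)]
    simp [Matrix.smul_single]
  rw [this]
  exact ContDiff.sum fun i _ => ContDiff.sum fun j _ => (h i j).smul contDiff_const

/-- Smoothness comes from that of inversion at a unit. The Stein solution is averaged with its
transpose, which solves the same equation; this yields symmetry without a uniqueness argument. -/
theorem exists_contDiffAt_valueMatrix (T : Task d r) : ∃ P : Policy d r → Matrix (Fin d) (Fin d) ℝ,
    ∀ w, T.Stable w →
      T.IsValueMatrix w (P w) ∧ ∀ i j, ContDiffAt ℝ 2 (fun v => P v i j) w := by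
  set X : Policy d r → Matrix (Fin d) (Fin d) ℝ := fun w =>
    steinSol (T.closedLoop w)ᵀ (T.closedLoop w) (T.costMatrix w)
  refine ⟨fun w => (1 / 2 : ℝ) • (X w + (X w)ᵀ), fun w hw => ?_⟩
  rw [stable_iff_tendsto_pow] at hw
  have hw' : Tendsto (fun n => (T.closedLoop w)ᵀ ^ n) atTop (𝓝 0) := by
    have : Continuous fun X : Matrix (Fin d) (Fin d) ℝ => Xᵀ := by fun_prop
    have := (this.tendsto 0).comp hw
    simpa [Function.comp_def, Matrix.transpose_pow] using this
  have heq : X w = T.costMatrix w + (T.closedLoop w)ᵀ * X w * T.closedLoop w :=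
    steinSol_eq hw' hw _
  have heq' : (X w)ᵀ = T.costMatrix w + (T.closedLoop w)ᵀ * (X w)ᵀ * T.closedLoop w := by
    conv_lhs => rw [heq]
    rw [Matrix.transpose_add, Matrix.transpose_mul, Matrix.transpose_mul,
      Matrix.transpose_transpose, T.transpose_costMatrix, mul_assoc]
  refine ⟨⟨by simp [add_comm], ?_⟩, fun i j => ?_⟩
  · refine (congrArg₂ (fun a b => (1 / 2 : ℝ) • (a + b)) heq heq').trans ?_
    simp only [mul_add, add_mul, smul_add, Matrix.mul_smul, Matrix.smul_mul]
    module
  have hc : ContDiff ℝ 2 T.closedLoop := contDiff_matrix fun i j => by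
    simp only [closedLoop, Policy.mat, Matrix.sub_apply, Matrix.mul_apply, Matrix.of_apply]
    fun_prop
  have ht : ContDiff ℝ 2 fun w => (T.closedLoop w)ᵀ := contDiff_matrix fun i j => by
    simp only [closedLoop, Policy.mat, Matrix.sub_apply, Matrix.mul_apply, Matrix.of_apply,
      Matrix.transpose_apply]
    fun_prop
  have hm : ContDiff ℝ 2 T.costMatrix := contDiff_matrix fun i j => by
    simp only [costMatrix, Policy.mat, Matrix.add_apply, Matrix.mul_apply, Matrix.of_apply,
      Matrix.transpose_apply]
    fun_prop
  have h1 := contDiffAt_steinSol ht.contDiffAt hc.contDiffAt hm.contDiffAt hw' hw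
  have h2 : ∀ i j, ContDiffAt ℝ 2 (fun v => X v i j) w := fun i j =>
    (LinearMap.toContinuousLinearMap
      (Matrix.entryLinearMap ℝ ℝ i j)).contDiff.contDiffAt.comp w h1
  simp only [Matrix.smul_apply, Matrix.add_apply, Matrix.transpose_apply]
  exact ((h2 i j).add (h2 j i)).const_smul _

end Norm

end Task
end LQR

/-! ### Series and quadratic forms -/

theorem ENNReal.tsum_ofReal_eq_of_tendsto {f : ℕ → ℝ} {L : ℝ} (hf : ∀ t, 0 ≤ f t)
    (h : Tendsto (fun n => ∑ t ∈ Finset.range n, f t) atTop (𝓝 L)) :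
    ∑' t, ENNReal.ofReal (f t) = ENNReal.ofReal L := by
  have h1 := (hasSum_iff_tendsto_nat_of_nonneg hf L).2 h
  rw [← ENNReal.ofReal_tsum_of_nonneg hf h1.summable, h1.tsum_eq]

theorem Matrix.mulVec_dotProduct {m n : Type*} [Fintype m] [Fintype n] (M : Matrix m n ℝ)
    (x : n → ℝ) (y : m → ℝ) : (M *ᵥ x) ⬝ᵥ y = x ⬝ᵥ (Mᵀ *ᵥ y) := by
  rw [Matrix.mulVec_transpose, dotProduct_comm x, ← Matrix.dotProduct_mulVec, dotProduct_comm]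

theorem Matrix.dotProduct_mulVec_comm_of_symm {n : Type*} [Fintype n] {M : Matrix n n ℝ}
    (hM : Mᵀ = M) (x y : n → ℝ) : x ⬝ᵥ (M *ᵥ y) = y ⬝ᵥ (M *ᵥ x) := by
  rw [dotProduct_comm, Matrix.mulVec_dotProduct, hM]

theorem Matrix.exists_dotProduct_mulVec_le {n : Type*} [Fintype n] (M : Matrix n n ℝ) :
    ∃ c : ℝ, 0 < c ∧ ∀ x : n → ℝ, x ⬝ᵥ (M *ᵥ x) ≤ c * (x ⬝ᵥ x) := by
  refine ⟨1 + ∑ i, ∑ j, |M i j|, by positivity, fun x => ?_⟩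
  have hx : ∀ i, |x i| ^ 2 ≤ x ⬝ᵥ x := fun i => by
    rw [sq_abs, sq]
    exact Finset.single_le_sum (f := fun i => x i * x i) (fun j _ => mul_self_nonneg _)
      (Finset.mem_univ i)
  have h0 : 0 ≤ x ⬝ᵥ x := Finset.sum_nonneg fun j _ => mul_self_nonneg _
  have h1 : ∀ i j, x i * (M i j * x j) ≤ |M i j| * (x ⬝ᵥ x) := fun i j => by
    have h2 : |x i| * |x j| ≤ x ⬝ᵥ x := by
      nlinarith [hx i, hx j, sq_nonneg (|x i| - |x j|)]
    calc x i * (M i j * x j) ≤ |x i * (M i j * x j)| := le_abs_self _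
      _ = |M i j| * (|x i| * |x j|) := by rw [abs_mul, abs_mul]; ring
      _ ≤ |M i j| * (x ⬝ᵥ x) := by gcongr
  have h3 : x ⬝ᵥ (M *ᵥ x) ≤ (∑ i, ∑ j, |M i j|) * (x ⬝ᵥ x) := by
    calc x ⬝ᵥ (M *ᵥ x) = ∑ i, ∑ j, x i * (M i j * x j) := by
          simp only [dotProduct, Matrix.mulVec, Finset.mul_sum]
      _ ≤ ∑ i, ∑ j, |M i j| * (x ⬝ᵥ x) :=
          Finset.sum_le_sum fun i _ => Finset.sum_le_sum fun j _ => h1 i j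
      _ = _ := by simp only [Finset.sum_mul]
  linarith

/-! ### Comparison of policies along single trajectories -/

namespace LQR

variable {d r : ℕ}

/-- The policy with a given matrix. -/
def Policy.ofMat (M : Matrix (Fin r) (Fin d) ℝ) : Policy d r :=
  WithLp.toLp 2 fun p => M p.1 p.2

theorem Policy.mat_sub_smul_ofMat (w : Policy d r) (ε : ℝ) (M : Matrix (Fin r) (Fin d) ℝ) :
    (w - ε • Policy.ofMat M).mat = w.mat - ε • M := by
  ext i j
  simp [Policy.mat, Policy.ofMat]

namespace Task

variable {T : Task d r} {w : Policy d r} {P : Matrix (Fin d) (Fin d) ℝ}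

theorem IsValueMatrix.dotProduct_mulVec (hP : T.IsValueMatrix w P) (s : Fin d → ℝ) :
    s ⬝ᵥ (P *ᵥ s) = T.stageCost s (w.action s) +
      (T.closedLoop w *ᵥ s) ⬝ᵥ (P *ᵥ (T.closedLoop w *ᵥ s)) := by
  conv_lhs => rw [hP.eq]
  rw [Matrix.add_mulVec, dotProduct_add, stageCost_action, Matrix.mulVec_dotProduct,
    Matrix.mulVec_mulVec, Matrix.mulVec_mulVec, Matrix.mul_assoc]

/-- The Lyapunov equation makes each stage cost a difference of consecutive values of the form P, so
the sum telescopes. -/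
theorem IsValueMatrix.sum_stageCost (hP : T.IsValueMatrix w P) (s : Fin d → ℝ) (n : ℕ) :
    ∑ t ∈ Finset.range n, T.stageCost (T.traj w s t) (w.action (T.traj w s t)) =
      s ⬝ᵥ (P *ᵥ s) - T.traj w s n ⬝ᵥ (P *ᵥ T.traj w s n) := by
  induction n with
  | zero => simp [traj]
  | succ n ih =>
    rw [Finset.sum_range_succ, ih, hP.dotProduct_mulVec (T.traj w s n), traj_succ]
    ring

theorem tendsto_mulVec_dotProduct_traj {f g : ℕ → Fin d → ℝ} (hf : Tendsto f atTop (𝓝 0))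
    (hg : Tendsto g atTop (𝓝 0)) (P : Matrix (Fin d) (Fin d) ℝ) :
    Tendsto (fun t => f t ⬝ᵥ (P *ᵥ g t)) atTop (𝓝 0) := by
  have h : Continuous fun p : (Fin d → ℝ) × (Fin d → ℝ) => p.1 ⬝ᵥ (P *ᵥ p.2) := by fun_prop
  have := (h.tendsto (0, 0)).comp (hf.prodMk_nhds hg)
  simpa [Function.comp_def] using this

theorem IsValueMatrix.tendsto_sum (hP : T.IsValueMatrix w P) (hw : T.Stable w)
    (s : Fin d → ℝ) :
    Tendsto (fun n => ∑ t ∈ Finset.range n, T.stageCost (T.traj w s t) (w.action (T.traj w s t)))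
      atTop (𝓝 (s ⬝ᵥ (P *ᵥ s))) := by
  simp only [hP.sum_stageCost]
  simpa using (tendsto_mulVec_dotProduct_traj (hw s) (hw s) P).const_sub (s ⬝ᵥ (P *ᵥ s))

theorem IsValueMatrix.nonneg (hP : T.IsValueMatrix w P) (hw : T.Stable w)
    (s : Fin d → ℝ) : 0 ≤ s ⬝ᵥ (P *ᵥ s) :=
  ge_of_tendsto' (hP.tendsto_sum hw s) fun _ =>
    Finset.sum_nonneg fun _ _ => T.stageCost_nonneg _ _

theorem IsValueMatrix.tsum_eq (hP : T.IsValueMatrix w P) (hw : T.Stable w)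
    (s : Fin d → ℝ) :
    ∑' t, ENNReal.ofReal (T.stageCost (T.traj w s t) (w.action (T.traj w s t))) =
      ENNReal.ofReal (s ⬝ᵥ (P *ᵥ s)) :=
  ENNReal.tsum_ofReal_eq_of_tendsto (fun _ => T.stageCost_nonneg _ _) (hP.tendsto_sum hw s)

/-- Half the gradient of the action value: `E = R W - Bᵀ P A_W`. -/
def advantage (T : Task d r) (w : Policy d r) (P : Matrix (Fin d) (Fin d) ℝ) :
    Matrix (Fin r) (Fin d) ℝ :=
  T.R * w.mat - T.Bᵀ * P * T.closedLoop w

theorem stageCost_add (T : Task d r) (x ξ : Fin d → ℝ) (a ν : Fin r → ℝ) :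
    T.stageCost (x + ξ) (a + ν) = T.stageCost x a + T.stageCost ξ ν +
      2 * (ξ ⬝ᵥ (T.Q *ᵥ x) + ν ⬝ᵥ (T.R *ᵥ a)) := by
  have hQ := Matrix.dotProduct_mulVec_comm_of_symm (M := T.Q) T.Q_posSemidef.1 x ξ
  have hR := Matrix.dotProduct_mulVec_comm_of_symm (M := T.R) T.R_posSemidef.1 a ν
  simp only [stageCost, Matrix.mulVec_add, dotProduct_add, add_dotProduct]
  linarith

theorem closedLoop_mulVec (T : Task d r) (w : Policy d r) (s : Fin d → ℝ) :
    T.closedLoop w *ᵥ s = T.A *ᵥ s + T.B *ᵥ w.action s := by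
  simpa [traj] using (T.traj_succ w s 0).symm

/-- One step of the performance difference formula along the direction `-E`. -/
theorem IsValueMatrix.stageCost_sub_smul_advantage (hP : T.IsValueMatrix w P) (ε : ℝ)
    (y : Fin d → ℝ) {v : Policy d r} (hv : v = w - ε • Policy.ofMat (T.advantage w P))
    {e : Fin r → ℝ} (he : e = T.advantage w P *ᵥ y) :
    T.stageCost y (v.action y) + (T.closedLoop v *ᵥ y) ⬝ᵥ (P *ᵥ (T.closedLoop v *ᵥ y)) +
        2 * ε * (e ⬝ᵥ e) =
      y ⬝ᵥ (P *ᵥ y) + ε ^ 2 * (e ⬝ᵥ ((T.R + T.Bᵀ * P * T.B) *ᵥ e)) := by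
  have hva : v.action y = w.action y + ε • e := by
    rw [Policy.action, hv, Policy.mat_sub_smul_ofMat, Policy.action, Matrix.sub_mulVec,
      Matrix.smul_mulVec, he]
    module
  have hvc : T.closedLoop v *ᵥ y = T.closedLoop w *ᵥ y + ε • (T.B *ᵥ e) := by
    rw [closedLoop_mulVec, closedLoop_mulVec, hva, Matrix.mulVec_add, Matrix.mulVec_smul, add_assoc]
  have hstage : T.stageCost y (w.action y + ε • e) = T.stageCost y (w.action y) +
      ε ^ 2 * (e ⬝ᵥ (T.R *ᵥ e)) + 2 * ε * (e ⬝ᵥ (T.R *ᵥ w.action y)) := by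
    have := T.stageCost_add y 0 (w.action y) (ε • e)
    rw [add_zero] at this
    rw [this]
    simp only [stageCost, Matrix.mulVec_smul, dotProduct_smul, smul_dotProduct, zero_dotProduct,
      smul_eq_mul]
    ring
  -- The terms linear in ε combine to -2ε e·e, by the definition of E.
  have hee : e ⬝ᵥ e = -(e ⬝ᵥ (T.R *ᵥ w.action y)) -
      (T.B *ᵥ e) ⬝ᵥ (P *ᵥ (T.closedLoop w *ᵥ y)) := by
    nth_rw 2 [he]
    rw [advantage, Matrix.sub_mulVec, dotProduct_sub, ← Matrix.mulVec_mulVec,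
      ← Matrix.mulVec_mulVec, ← Matrix.mulVec_mulVec, Matrix.mulVec_dotProduct, Policy.action,
      Matrix.mulVec_neg, dotProduct_neg, neg_neg]
  have hsymm := Matrix.dotProduct_mulVec_comm_of_symm hP.symm (T.closedLoop w *ᵥ y) (T.B *ᵥ e)
  have hN : e ⬝ᵥ ((T.R + T.Bᵀ * P * T.B) *ᵥ e) =
      e ⬝ᵥ (T.R *ᵥ e) + (T.B *ᵥ e) ⬝ᵥ (P *ᵥ (T.B *ᵥ e)) := by
    rw [Matrix.add_mulVec, dotProduct_add, Matrix.mulVec_dotProduct, Matrix.mulVec_mulVec,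
      Matrix.mulVec_mulVec, Matrix.mul_assoc]
  rw [hva, hvc, hstage, hN, hP.dotProduct_mulVec y]
  simp only [Matrix.mulVec_add, Matrix.mulVec_smul, dotProduct_add, add_dotProduct,
    dotProduct_smul, smul_dotProduct, smul_eq_mul]
  rw [hsymm]
  linear_combination (2 * ε) * hee

/-- A small step along `-E` improves the cost of every trajectory. -/
theorem IsValueMatrix.exists_tsum_add_le (hP : T.IsValueMatrix w P) (hw : T.Stable w) :
    ∃ ε₀ > 0, ∀ ε, 0 < ε → ε ≤ ε₀ → ∀ v, v = w - ε • Policy.ofMat (T.advantage w P) → ∀ s,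
      (∑' t, ENNReal.ofReal (T.stageCost (T.traj v s t) (v.action (T.traj v s t)))) +
        (∑' t, ENNReal.ofReal (ε * ((T.advantage w P *ᵥ T.traj v s t) ⬝ᵥ
          (T.advantage w P *ᵥ T.traj v s t)))) ≤ ENNReal.ofReal (s ⬝ᵥ (P *ᵥ s)) := by
  obtain ⟨c, hc, hN⟩ := Matrix.exists_dotProduct_mulVec_le (T.R + T.Bᵀ * P * T.B)
  -- With ε c ≤ 1 the quadratic error is at most ε e·e, which leaves half of the first-order gain 2ε
  -- e·e.
  refine ⟨c⁻¹, inv_pos.2 hc, fun ε hε hεc v hv s => ?_⟩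
  have he : ∀ t, 0 ≤ (T.advantage w P *ᵥ T.traj v s t) ⬝ᵥ (T.advantage w P *ᵥ T.traj v s t) :=
    fun t => Finset.sum_nonneg fun j _ => mul_self_nonneg _
  have hstep : ∀ y, T.stageCost y (v.action y) +
      ε * ((T.advantage w P *ᵥ y) ⬝ᵥ (T.advantage w P *ᵥ y)) +
      (T.closedLoop v *ᵥ y) ⬝ᵥ (P *ᵥ (T.closedLoop v *ᵥ y)) ≤ y ⬝ᵥ (P *ᵥ y) := by
    intro y
    have h1 := hP.stageCost_sub_smul_advantage ε y hv rfl
    have h2 := hN (T.advantage w P *ᵥ y)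
    have h0 : 0 ≤ (T.advantage w P *ᵥ y) ⬝ᵥ (T.advantage w P *ᵥ y) :=
      Finset.sum_nonneg fun j _ => mul_self_nonneg _
    have h3 : ε * c ≤ 1 := by
      rwa [← le_div_iff₀ hc, one_div]
    have h4 : ε ^ 2 * ((T.advantage w P *ᵥ y) ⬝ᵥ
        ((T.R + T.Bᵀ * P * T.B) *ᵥ (T.advantage w P *ᵥ y))) ≤
        ε * ((T.advantage w P *ᵥ y) ⬝ᵥ (T.advantage w P *ᵥ y)) := by
      calc _ ≤ ε ^ 2 * (c * ((T.advantage w P *ᵥ y) ⬝ᵥ (T.advantage w P *ᵥ y))) := by gcongr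
        _ = (ε * c) * (ε * ((T.advantage w P *ᵥ y) ⬝ᵥ (T.advantage w P *ᵥ y))) := by ring
        _ ≤ 1 * (ε * ((T.advantage w P *ᵥ y) ⬝ᵥ (T.advantage w P *ᵥ y))) := by gcongr
        _ = _ := one_mul _
    linarith
  rw [← ENNReal.tsum_add, ENNReal.tsum_eq_iSup_nat]
  refine iSup_le fun n => ?_
  simp only [← ENNReal.ofReal_add (T.stageCost_nonneg _ _) (mul_nonneg hε.le (he _))]
  rw [← ENNReal.ofReal_sum_of_nonneg
    fun t _ => add_nonneg (T.stageCost_nonneg _ _) (mul_nonneg hε.le (he t))]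
  refine ENNReal.ofReal_le_ofReal ?_
  have hsum : ∀ n, ∑ t ∈ Finset.range n, (T.stageCost (T.traj v s t) (v.action (T.traj v s t)) +
      ε * ((T.advantage w P *ᵥ T.traj v s t) ⬝ᵥ (T.advantage w P *ᵥ T.traj v s t))) +
      T.traj v s n ⬝ᵥ (P *ᵥ T.traj v s n) ≤ s ⬝ᵥ (P *ᵥ s) := by
    intro n
    induction n with
    | zero => simp [traj]
    | succ n ih =>
      rw [Finset.sum_range_succ, traj_succ]
      linarith [hstep (T.traj v s n)]
  linarith [hsum n, hP.nonneg hw (T.traj v s n)]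

/-- If `E s_t = 0` along the trajectory from `s`, then the policy is optimal from `s`. -/
theorem IsValueMatrix.dotProduct_mulVec_le_of_advantage_eq_zero (hP : T.IsValueMatrix w P) (hw : T.Stable w)
    {s : Fin d → ℝ} (hs : ∀ t, T.advantage w P *ᵥ T.traj w s t = 0) {v : Policy d r}
    {P' : Matrix (Fin d) (Fin d) ℝ} (hP' : T.IsValueMatrix v P') (hv : T.Stable v) :
    s ⬝ᵥ (P *ᵥ s) ≤ s ⬝ᵥ (P' *ᵥ s) := by
  -- First-order convexity inequality for the stage cost, with the linear terms rewritten through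
  -- the costate 2 P x so that they telescope over time.
  have hstep : ∀ x y, T.advantage w P *ᵥ x = 0 →
      T.stageCost x (w.action x) + 2 * ((y - x) ⬝ᵥ (P *ᵥ x)) ≤ T.stageCost y (v.action y) +
        2 * ((T.closedLoop v *ᵥ y - T.closedLoop w *ᵥ x) ⬝ᵥ (P *ᵥ (T.closedLoop w *ᵥ x))) := by
    intro x y hx
    have h1 := T.stageCost_add x (y - x) (w.action x) (v.action y - w.action x)
    rw [add_sub_cancel, add_sub_cancel] at h1
    have h2 := T.stageCost_nonneg (y - x) (v.action y - w.action x)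
    have h3 : T.closedLoop v *ᵥ y - T.closedLoop w *ᵥ x =
        T.A *ᵥ (y - x) + T.B *ᵥ (v.action y - w.action x) := by
      rw [closedLoop_mulVec, closedLoop_mulVec, Matrix.mulVec_sub, Matrix.mulVec_sub]
      abel
    have hx' : T.R *ᵥ (w.mat *ᵥ x) = T.Bᵀ *ᵥ (P *ᵥ (T.closedLoop w *ᵥ x)) := by
      rw [advantage, Matrix.sub_mulVec, sub_eq_zero] at hx
      simpa only [Matrix.mulVec_mulVec, Matrix.mul_assoc] using hx
    -- Costate recursion: E x = 0 cancels the W-dependent part of the Lyapunov equation.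
    have h4 : P *ᵥ x = T.Q *ᵥ x + T.Aᵀ *ᵥ (P *ᵥ (T.closedLoop w *ᵥ x)) := by
      have : P *ᵥ x = T.Q *ᵥ x + w.matᵀ *ᵥ (T.R *ᵥ (w.mat *ᵥ x)) +
          (T.closedLoop w)ᵀ *ᵥ (P *ᵥ (T.closedLoop w *ᵥ x)) := by
        conv_lhs => rw [hP.eq]
        simp only [costMatrix, Matrix.add_mulVec, Matrix.mulVec_mulVec, Matrix.mul_assoc]
      rw [this, hx']
      nth_rw 2 [closedLoop]
      rw [Matrix.transpose_sub, Matrix.sub_mulVec, Matrix.transpose_mul, ← Matrix.mulVec_mulVec]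
      abel
    have h5 : T.R *ᵥ w.action x = -(T.Bᵀ *ᵥ (P *ᵥ (T.closedLoop w *ᵥ x))) := by
      rw [Policy.action, Matrix.mulVec_neg, hx']
    rw [h1, h3, h4, h5]
    simp only [add_dotProduct, dotProduct_add, dotProduct_neg, Matrix.mulVec_dotProduct]
    linarith
  have hsum : ∀ n, ∑ t ∈ Finset.range n, T.stageCost (T.traj w s t) (w.action (T.traj w s t)) ≤
      ∑ t ∈ Finset.range n, T.stageCost (T.traj v s t) (v.action (T.traj v s t)) +
        2 * ((T.traj v s n - T.traj w s n) ⬝ᵥ (P *ᵥ T.traj w s n)) := by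
    intro n
    induction n with
    | zero => simp [traj]
    | succ n ih =>
      rw [Finset.sum_range_succ, Finset.sum_range_succ, traj_succ, traj_succ]
      linarith [hstep (T.traj w s n) (T.traj v s n) (hs n)]
  refine le_of_tendsto_of_tendsto' (hP.tendsto_sum hw s) ?_ hsum
  -- The boundary term vanishes because both trajectories tend to 0.
  have h1 := tendsto_mulVec_dotProduct_traj ((hv s).sub (hw s) |>.trans (by simp)) (hw s) P
  simpa using (hP'.tendsto_sum hv s).add (h1.const_mul 2)

end Task
end LQR

/-! ### Normalized steps in an inner product space -/

section InnerProductSpace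

variable {F : Type*} [NormedAddCommGroup F] [InnerProductSpace ℝ F]

/-- The squared distance of the unit vectors times ‖x‖‖y‖ equals ‖x - y‖² - (‖x‖ - ‖y‖)². -/
theorem norm_inv_norm_smul_sub_le {x y : F} {m : ℝ} (hm : 0 < m) (hx : m ≤ ‖x‖) (hy : m ≤ ‖y‖) :
    ‖‖x‖⁻¹ • x - ‖y‖⁻¹ • y‖ ≤ ‖x - y‖ / m := by
  have hx0 : 0 < ‖x‖ := hm.trans_le hx
  have hy0 : 0 < ‖y‖ := hm.trans_le hy
  have h1 : ‖‖x‖⁻¹ • x - ‖y‖⁻¹ • y‖ ^ 2 * (‖x‖ * ‖y‖) = ‖x - y‖ ^ 2 - (‖x‖ - ‖y‖) ^ 2 := by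
    rw [norm_sub_sq_real, norm_sub_sq_real, norm_smul, norm_smul, real_inner_smul_left,
      real_inner_smul_right, norm_inv, norm_inv, norm_norm, norm_norm]
    field_simp
    ring
  rw [le_div_iff₀ hm]
  refine le_of_sq_le_sq ?_ (norm_nonneg _)
  calc (‖‖x‖⁻¹ • x - ‖y‖⁻¹ • y‖ * m) ^ 2 = ‖‖x‖⁻¹ • x - ‖y‖⁻¹ • y‖ ^ 2 * (m * m) := by ring
    _ ≤ ‖‖x‖⁻¹ • x - ‖y‖⁻¹ • y‖ ^ 2 * (‖x‖ * ‖y‖) := by gcongr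
    _ ≤ ‖x - y‖ ^ 2 := by rw [h1]; linarith [sq_nonneg (‖x‖ - ‖y‖)]

/-- If `η ‖Dg(x)‖ < ‖g(x)‖`, the normalized step `v ↦ v - η g(v) / ‖g(v)‖` is open at `x`. -/
theorem map_nhds_sub_normalized_eq [CompleteSpace F] {g : F → F} {g' : F →L[ℝ] F} {x : F}
    (hg : HasStrictFDerivAt g g' x) {η : ℝ} (hη : 0 < η) (h : η * ‖g'‖ < ‖g x‖) :
    map (fun v => v - (η / ‖g v‖) • g v) (𝓝 x) = 𝓝 (x - (η / ‖g x‖) • g x) := by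
  -- Choose ‖g'‖ < K and η K < m < ‖g x‖: near x, K is a Lipschitz constant of g and m a lower bound
  -- for its norm, so the step differs from the identity by a map with Lipschitz constant η K / m <
  -- 1.
  obtain ⟨K, hK, hKg⟩ := exists_between ((lt_div_iff₀' hη).2 h)
  lift K to ℝ≥0 using (norm_nonneg _).trans hK.le
  obtain ⟨m, hKm, hmg⟩ := exists_between ((lt_div_iff₀' hη).1 hKg)
  have hm : 0 < m := (mul_nonneg hη.le K.2).trans_lt hKm
  obtain ⟨s, hs, hLip⟩ := hg.exists_lipschitzOnWith_of_nnnorm_lt K (by exact_mod_cast hK)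
  have hnorm : ∀ᶠ v in 𝓝 x, m < ‖g v‖ :=
    hg.continuousAt.norm.eventually (lt_mem_nhds hmg)
  obtain ⟨c, hc⟩ : ∃ c : ℝ≥0, (c : ℝ) = η * K / m := ⟨⟨η * K / m, by positivity⟩, rfl⟩
  have happ : ApproximatesLinearOn (fun v => v - (η / ‖g v‖) • g v)
      (ContinuousLinearMap.id ℝ F) (s ∩ {v | m < ‖g v‖}) c := by
    rintro a ⟨has, ham⟩ b ⟨hbs, hbm⟩
    have h1 : a - (η / ‖g a‖) • g a - (b - (η / ‖g b‖) • g b) - ContinuousLinearMap.id ℝ F (a - b) =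
        -(η • (‖g a‖⁻¹ • g a - ‖g b‖⁻¹ • g b)) := by
      simp only [ContinuousLinearMap.id_apply, div_eq_mul_inv, mul_smul, smul_sub]
      abel
    have h2 := hLip.norm_sub_le has hbs
    rw [h1, norm_neg, norm_smul, Real.norm_of_nonneg hη.le]
    calc η * ‖‖g a‖⁻¹ • g a - ‖g b‖⁻¹ • g b‖ ≤ η * (‖g a - g b‖ / m) := by
          gcongr
          exact norm_inv_norm_smul_sub_le hm (le_of_lt ham) (le_of_lt hbm)
      _ ≤ η * (K * ‖a - b‖ / m) := by gcongr
      _ = c * ‖a - b‖ := by rw [hc]; ring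
  refine happ.map_nhds_eq
    { toFun := id, nnnorm := 1, bound' := by simp, right_inv' := by simp }
    (inter_mem hs hnorm) (Or.inr ?_)
  rw [inv_one, ← NNReal.coe_lt_coe, hc, NNReal.coe_one, div_lt_one hm]
  exact hKm

theorem gradient_const_smul [CompleteSpace F] (f : F → ℝ) (c : ℝ) (x : F) :
    gradient (fun v => c * f v) x = c • gradient f x := by
  have : fderiv ℝ (fun v => c * f v) x = c • fderiv ℝ f x :=
    congrFun (fderiv_const_smul_field (f := f) c) x
  simp only [gradient, this, map_smulₛₗ, conj_trivial]

end InnerProductSpace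

/-! ### The expected cost: smoothness and local minimizers -/

namespace LQR

variable {d r : ℕ}

namespace Task

theorem dotProduct_mulVec_eq_sum (P : Matrix (Fin d) (Fin d) ℝ) (s : Fin d → ℝ) :
    s ⬝ᵥ (P *ᵥ s) = ∑ i, ∑ j, P i j * (s i * s j) := by
  simp only [dotProduct, Matrix.mulVec, Finset.mul_sum]
  exact Finset.sum_congr rfl fun i _ => Finset.sum_congr rfl fun j _ => by ring

section Measure

variable {T₀ : Measure (Fin d → ℝ)}

theorem integrable_mul_coord (hT₀ : MemLp (fun s : Fin d → ℝ => s) 2 T₀) (i j : Fin d) :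
    Integrable (fun s : Fin d → ℝ => s i * s j) T₀ := by
  have h : ∀ i : Fin d, MemLp (fun s : Fin d → ℝ => s i) 2 T₀ := fun i =>
    hT₀.mono (measurable_pi_apply i).aestronglyMeasurable
      (Eventually.of_forall fun s => norm_le_pi_norm s i)
  exact (h i).integrable_mul (h j)

theorem IsValueMatrix.cost_eq_lintegral {T : Task d r} {w : Policy d r}
    {P : Matrix (Fin d) (Fin d) ℝ} (hP : T.IsValueMatrix w P) (hw : T.Stable w) :
    T.cost T₀ w = ∫⁻ s, ENNReal.ofReal (s ⬝ᵥ (P *ᵥ s)) ∂T₀ := by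
  rw [cost, if_pos hw]
  simp only [hP.tsum_eq hw]

theorem IsValueMatrix.cost_eq {T : Task d r} {w : Policy d r} {P : Matrix (Fin d) (Fin d) ℝ}
    (hP : T.IsValueMatrix w P) (hw : T.Stable w)
    (hT₀ : MemLp (fun s : Fin d → ℝ => s) 2 T₀) :
    T.cost T₀ w = ENNReal.ofReal (∫ s, s ⬝ᵥ (P *ᵥ s) ∂T₀) := by
  have hint : Integrable (fun s => s ⬝ᵥ (P *ᵥ s)) T₀ := by
    simp only [dotProduct_mulVec_eq_sum]
    exact integrable_finsetSum _ fun i _ => integrable_finsetSum _ fun j _ =>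
      (integrable_mul_coord hT₀ i j).const_mul _
  rw [hP.cost_eq_lintegral hw, ofReal_integral_eq_lintegral_ofReal hint
    (Eventually.of_forall (hP.nonneg hw))]

/-- The cost is linear in the entries of P, with the second moments of the initial law as
coefficients, so it inherits the smoothness of P. -/
theorem IsValueMatrix.toReal_cost {T : Task d r} {w : Policy d r} {P : Matrix (Fin d) (Fin d) ℝ}
    (hP : T.IsValueMatrix w P) (hw : T.Stable w)
    (hT₀ : MemLp (fun s : Fin d → ℝ => s) 2 T₀) :
    (T.cost T₀ w).toReal = ∑ i, ∑ j, P i j * ∫ s, s i * s j ∂T₀ := by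
  rw [hP.cost_eq hw hT₀, ENNReal.toReal_ofReal (integral_nonneg (hP.nonneg hw))]
  simp only [dotProduct_mulVec_eq_sum]
  have h : ∀ i j, Integrable (fun s : Fin d → ℝ => P i j * (s i * s j)) T₀ := fun i j =>
    (integrable_mul_coord hT₀ i j).const_mul _
  rw [integral_finsetSum _ fun i _ => integrable_finsetSum _ fun j _ => h i j]
  refine Finset.sum_congr rfl fun i _ => ?_
  rw [integral_finsetSum _ fun j _ => h i j]
  exact Finset.sum_congr rfl fun j _ => integral_const_mul _ _

theorem contDiffAt_toReal_cost (T : Task d r) (hT₀ : MemLp (fun s : Fin d → ℝ => s) 2 T₀)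
    {w : Policy d r} (hw : T.Stable w) :
    ContDiffAt ℝ 2 (fun v => (T.cost T₀ v).toReal) w := by
  obtain ⟨P, hP⟩ := T.exists_contDiffAt_valueMatrix
  have h1 : ContDiffAt ℝ 2 (fun v => ∑ i, ∑ j, P v i j * ∫ s, s i * s j ∂T₀) w :=
    ContDiffAt.sum fun i _ => ContDiffAt.sum fun j _ => ((hP w hw).2 i j).mul contDiffAt_const
  refine h1.congr_of_eventuallyEq ?_
  filter_upwards [T.isOpen_stable.mem_nhds hw] with v hv
  exact (hP v hv).1.toReal_cost hv hT₀

theorem contDiffAt_grad (T : Task d r) (hT₀ : MemLp (fun s : Fin d → ℝ => s) 2 T₀)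
    {w : Policy d r} (hw : T.Stable w) : ContDiffAt ℝ 1 (T.grad T₀) w := by
  have h1 : ContDiffAt ℝ 1 (fderiv ℝ fun v => (T.cost T₀ v).toReal) w :=
    (T.contDiffAt_toReal_cost hT₀ hw).fderiv_right (by norm_num)
  refine contDiffAt_euclidean.2 fun p => ?_
  have h2 : (fun v => T.grad T₀ v p) = fun v =>
      fderiv ℝ (fun v => (T.cost T₀ v).toReal) v (EuclideanSpace.single p 1) := by
    funext v
    rw [grad, gradient, ← InnerProductSpace.toDual_symm_apply (𝕜 := ℝ), real_inner_comm]
    simp [EuclideanSpace.inner_single_left]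
  rw [h2]
  exact h1.clm_apply contDiffAt_const

theorem map_nhds_adapt (T : Task d r) (hT₀ : MemLp (fun s : Fin d → ℝ => s) 2 T₀)
    {w : Policy d r} (hw : T.Stable w) {η : ℝ} (hη : 0 < η)
    (h : η * ‖T.hess T₀ w‖ < ‖T.grad T₀ w‖) :
    map (T.adapt T₀ η) (𝓝 w) = 𝓝 (T.adapt T₀ η w) :=
  map_nhds_sub_normalized_eq ((T.contDiffAt_grad hT₀ hw).hasStrictFDerivAt one_ne_zero) hη h

/-- A step along -E gains at least the integral of a nonnegative function. Local minimality and
finiteness of the cost force this integral to be 0. -/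
theorem ae_advantage_eq_zero (T : Task d r) (hT₀ : MemLp (fun s : Fin d → ℝ => s) 2 T₀)
    {w : Policy d r} (hw : T.Stable w) (hloc : IsLocalMin (T.cost T₀) w)
    {P : Matrix (Fin d) (Fin d) ℝ} (hP : T.IsValueMatrix w P) :
    ∀ᵐ s ∂T₀, ∀ t, T.advantage w P *ᵥ T.traj w s t = 0 := by
  obtain ⟨ε₀, hε₀, himp⟩ := hP.exists_tsum_add_le hw
  have hcont : Tendsto (fun ε : ℝ => w - ε • Policy.ofMat (T.advantage w P)) (𝓝[>] 0) (𝓝 w) := by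
    have : Continuous fun ε : ℝ => w - ε • Policy.ofMat (T.advantage w P) := by fun_prop
    have := this.tendsto 0
    rw [zero_smul, sub_zero] at this
    exact this.mono_left nhdsWithin_le_nhds
  obtain ⟨ε, ⟨⟨hmin, hst⟩, hεε₀⟩, hε⟩ := (((hcont.eventually hloc).and
    (hcont.eventually (T.isOpen_stable.mem_nhds hw))).and
    (mem_nhdsWithin_of_mem_nhds (Iic_mem_nhds hε₀))).and self_mem_nhdsWithin |>.exists
  set v := w - ε • Policy.ofMat (T.advantage w P) with hv
  have hε' : 0 < ε := hε
  have hst' : T.Stable v := hst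
  set G : (Fin d → ℝ) → ℝ≥0∞ := fun s => ∑' t, ENNReal.ofReal
    (ε * ((T.advantage w P *ᵥ T.traj v s t) ⬝ᵥ (T.advantage w P *ᵥ T.traj v s t))) with hG
  have hGmeas : Measurable G := by
    refine Measurable.tsum fun t => ENNReal.measurable_ofReal.comp ?_
    have := T.continuous_traj v t
    refine Continuous.measurable ?_
    fun_prop
  have hle : T.cost T₀ v + ∫⁻ s, G s ∂T₀ ≤ T.cost T₀ w := by
    rw [hP.cost_eq_lintegral hw, cost, if_pos hst', ← lintegral_add_right _ hGmeas]
    exact lintegral_mono fun s => himp ε hε' hεε₀ v hv s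
  have hfin : T.cost T₀ v ≠ ∞ := by
    refine ne_top_of_le_ne_top ?_ (le_self_add.trans hle)
    rw [hP.cost_eq hw hT₀]
    exact ENNReal.ofReal_ne_top
  have hG0 : ∫⁻ s, G s ∂T₀ = 0 := by
    have h1 : T.cost T₀ v + ∫⁻ s, G s ∂T₀ ≤ T.cost T₀ v + 0 := by
      rw [add_zero]
      exact hle.trans hmin
    exact le_zero_iff.1 ((ENNReal.add_le_add_iff_left hfin).1 h1)
  filter_upwards [(lintegral_eq_zero_iff hGmeas).1 hG0] with s hs
  have hs' : ∀ t, T.advantage w P *ᵥ T.traj v s t = 0 := by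
    intro t
    have h1 := ENNReal.tsum_eq_zero.1 hs t
    rw [ENNReal.ofReal_eq_zero] at h1
    have h2 := nonpos_of_mul_nonpos_right h1 hε'
    exact dotProduct_self_eq_zero.1
      (le_antisymm h2 (Finset.sum_nonneg fun j _ => mul_self_nonneg _))
  -- The two policies differ by ε E, which vanishes along the trajectory of `v`, so both generate
  -- the same trajectory.
  have htraj : ∀ t, T.traj v s t = T.traj w s t := by
    intro t
    induction t with
    | zero => rfl
    | succ t ih =>
      have h1 : v.action (T.traj v s t) = w.action (T.traj v s t) := by
        rw [Policy.action, hv, Policy.mat_sub_smul_ofMat, ← hv, Matrix.sub_mulVec,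
          Matrix.smul_mulVec, hs' t, smul_zero, sub_zero, Policy.action]
      rw [traj, traj, h1, ih]
  exact fun t => htraj t ▸ hs' t

/-- Local minimizers of the LQR cost are global minimizers. -/
theorem cost_le_of_isLocalMin (T : Task d r) (hT₀ : MemLp (fun s : Fin d → ℝ => s) 2 T₀)
    {w : Policy d r} (hw : T.Stable w) (hloc : IsLocalMin (T.cost T₀) w) (v : Policy d r) :
    T.cost T₀ w ≤ T.cost T₀ v := by
  by_cases hv : T.Stable v
  · obtain ⟨P, hP⟩ := T.exists_contDiffAt_valueMatrix
    rw [(hP w hw).1.cost_eq_lintegral hw, (hP v hv).1.cost_eq_lintegral hv]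
    refine lintegral_mono_ae ?_
    filter_upwards [T.ae_advantage_eq_zero hT₀ hw hloc (hP w hw).1] with s hs
    exact ENNReal.ofReal_le_ofReal
      ((hP w hw).1.dotProduct_mulVec_le_of_advantage_eq_zero hw hs (hP v hv).1 hv)
  · rw [cost.eq_1 T T₀ v, if_neg hv]
    exact le_top

/-! ### Tasks with proportional costs -/

section Scaling

variable {T T' : Task d r} {c : ℝ}

theorem traj_congr (hA : T.A = T'.A) (hB : T.B = T'.B) : T.traj = T'.traj := by
  funext w s t
  simp only [traj_eq, closedLoop, hA, hB]

theorem stable_congr (hA : T.A = T'.A) (hB : T.B = T'.B) (w : Policy d r) :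
    T.Stable w ↔ T'.Stable w := by
  simp only [Stable, traj_congr hA hB]

theorem cost_smul (hA : T.A = T'.A) (hB : T.B = T'.B) (hc : 0 < c) (hQ : T.Q = c • T'.Q)
    (hR : T.R = c • T'.R) (w : Policy d r) :
    T.cost T₀ w = ENNReal.ofReal c * T'.cost T₀ w := by
  have hstage : ∀ s a, T.stageCost s a = c * T'.stageCost s a := by
    intro s a
    simp only [stageCost, hQ, hR, Matrix.smul_mulVec, dotProduct_smul, smul_eq_mul]
    ring
  by_cases hw : T.Stable w
  · rw [cost, cost, if_pos hw, if_pos ((stable_congr hA hB w).1 hw),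
      ← lintegral_const_mul' _ _ ENNReal.ofReal_ne_top]
    simp only [hstage, ENNReal.ofReal_mul hc.le, ENNReal.tsum_mul_left, traj_congr hA hB]
  · rw [cost, cost, if_neg hw, if_neg (mt (stable_congr hA hB w).2 hw),
      ENNReal.mul_top (ENNReal.ofReal_pos.2 hc).ne']

/-- The gradient scales by c > 0, and normalization cancels c. Division by zero being 0, this also
covers a vanishing gradient. -/
theorem adapt_smul (hA : T.A = T'.A) (hB : T.B = T'.B) (hc : 0 < c) (hQ : T.Q = c • T'.Q)
    (hR : T.R = c • T'.R) (η : ℝ) (w : Policy d r) :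
    T.adapt T₀ η w = T'.adapt T₀ η w := by
  have hgrad : T.grad T₀ w = c • T'.grad T₀ w := by
    simp only [grad, cost_smul hA hB hc hQ hR, ENNReal.toReal_mul, ENNReal.toReal_ofReal hc.le]
    exact gradient_const_smul _ _ _
  rw [adapt, adapt, hgrad, norm_smul, Real.norm_of_nonneg hc.le, smul_smul]
  congr 2
  field_simp

end Scaling

end Measure

end Task

end LQR

/-! ### Transfer from the cost to the objective -/

theorem mainTheorem3 {d r k : ℕ} (T : Fin k → LQR.Task d r)
    (T₀ : MeasureTheory.Measure (Fin d → ℝ)) [MeasureTheory.IsProbabilityMeasure T₀]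
    (hT₀ : MeasureTheory.MemLp (fun s : Fin d → ℝ => s) 2 T₀)
    (hA : ∀ i j, (T i).A = (T j).A)
    (hB : ∀ i j, (T i).B = (T j).B)
    (α : Fin k → ℝ) (hα : ∀ i, 0 < α i)
    (hQ : ∀ i j, α i • (T i).Q = α j • (T j).Q)
    (hR : ∀ i j, α i • (T i).R = α j • (T j).R)
    (ω : Fin k → NNReal) (η : ℝ) (hη : 0 < η)
    (w : LQR.Policy d r)
    (hfin : LQR.mamlObjective T T₀ ω η w ≠ ⊤)
    (hloc : IsLocalMin (LQR.mamlObjective T T₀ ω η) w)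
    (hstep : ∃ i, η * ‖(T i).hess T₀ w‖ < ‖(T i).grad T₀ w‖) :
    ∀ v : LQR.Policy d r, LQR.mamlObjective T T₀ ω η w ≤ LQR.mamlObjective T T₀ ω η v := by
  obtain ⟨i₀, hi₀⟩ := hstep
  have hc : ∀ i, 0 < (α i)⁻¹ * α i₀ := fun i => mul_pos (inv_pos.2 (hα i)) (hα i₀)
  have hQ' : ∀ i, (T i).Q = ((α i)⁻¹ * α i₀) • (T i₀).Q := fun i => by
    rw [mul_smul, ← hQ i i₀, inv_smul_smul₀ (hα i).ne']
  have hR' : ∀ i, (T i).R = ((α i)⁻¹ * α i₀) • (T i₀).R := fun i => by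
    rw [mul_smul, ← hR i i₀, inv_smul_smul₀ (hα i).ne']
  set K : ℝ≥0∞ := ∑ i, (ω i : ℝ≥0∞) * ENNReal.ofReal ((α i)⁻¹ * α i₀) with hK
  have hobj : ∀ v, (T i₀).Stable v →
      LQR.mamlObjective T T₀ ω η v = K * (T i₀).cost T₀ ((T i₀).adapt T₀ η v) := by
    intro v hv
    rw [LQR.mamlObjective,
      if_pos fun i => (LQR.Task.stable_congr (hA i i₀) (hB i i₀) v).2 hv, hK, Finset.sum_mul]
    refine Finset.sum_congr rfl fun i _ => ?_
    rw [LQR.Task.adapt_smul (hA i i₀) (hB i i₀) (hc i) (hQ' i) (hR' i),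
      LQR.Task.cost_smul (hA i i₀) (hB i i₀) (hc i) (hQ' i) (hR' i), mul_assoc]
  have hobj_top : ∀ v, ¬ (T i₀).Stable v → LQR.mamlObjective T T₀ ω η v = ∞ := by
    intro v hv
    rw [LQR.mamlObjective, if_neg fun h => hv (h i₀)]
  have hw : (T i₀).Stable w := by
    by_contra h
    exact hfin (hobj_top w h)
  intro v
  by_cases hv : (T i₀).Stable v
  swap
  · rw [hobj_top v hv]
    exact le_top
  rw [hobj w hw, hobj v hv]
  -- If K = 0, the objective is 0 at every stable policy.
  rcases eq_or_ne K 0 with hK0 | hK0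
  · simp [hK0]
  have hKtop : K ≠ ∞ := ENNReal.sum_ne_top.2 fun i _ =>
    ENNReal.mul_ne_top ENNReal.coe_ne_top ENNReal.ofReal_ne_top
  -- An unstable adapted policy would have infinite cost, and K ≠ 0 would make the objective
  -- infinite.
  have hU : (T i₀).Stable ((T i₀).adapt T₀ η w) := by
    by_contra h
    rw [hobj w hw, LQR.Task.cost, if_neg h, ENNReal.mul_top hK0] at hfin
    exact hfin rfl
  have hlocU : IsLocalMin ((T i₀).cost T₀) ((T i₀).adapt T₀ η w) := by
    -- Openness of the step: the policies near the adapted one are described by adapting policies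
    -- near `w`, where `hloc` applies.
    rw [IsLocalMin, IsMinFilter, ← (T i₀).map_nhds_adapt hT₀ hw hη hi₀, eventually_map]
    filter_upwards [hloc, (T i₀).isOpen_stable.mem_nhds hw] with u hu hus
    rw [hobj w hw, hobj u hus] at hu
    exact (ENNReal.mul_le_mul_iff_right hK0 hKtop).1 hu
  gcongr
  exact (T i₀).cost_le_of_isLocalMin hT₀ hU hlocU _
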